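/- For integers $n,k\ge 0$ let $[n]^k$ denote the cubical $k$-dimensional grid graph: its vertices are the points of $\{0,\dots,n-1\}^k$, and two vertices are adjacent if and only if they differ in exactly one coordinate, and by exactly $1$ there. For each axis $i\in\{1,\dots,k\}$ the grid has two faces orthogonal to $i$, $\{x : x_i=0\}$ and $\{x : x_i=n-1\}$, so it has $2k$ faces in all. For odd $c$, the center $[d]^{k-1}$ area of a face of $[cd]^k$ orthogonal to axis $i$ is the set of its points $x$ with $\frac{c-1}{2}d\le x_j<\frac{c+1}{2}d$ for every $j\ne i$. Lemma (Vertex Disjoint Paths in High Dimensional Grids). There is an odd constant $c$, independent of $k$ and of $d$, and $c=15$ is such a constant, with the following property. Let $k\ge 1$ and $d\ge 1$ be integers, let $f_1$ and $f_2$ be any two distinct faces of the grid $[cd]^k$, and let $P_1$ and $P_2$ be sets of points in the center $[d]^{k-1}$ areas of $f_1$ and $f_2$, respectively, with $|P_1|=|P_2|$. Then there are a bijection $\sigma\colon P_1\to P_2$ and $|P_1|$ pairwise vertex-disjoint paths in the grid $[cd]^k$, one from $x$ to $\sigma(x)$ for each $x\in P_1$. -/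

import Mathlib

/-- The cubical `k`-dimensional grid graph `[n]^k`: the vertices are the points of
`{0, …, n-1}^k`, and two vertices are adjacent iff they differ in exactly one coordinate,
and by exactly one there. -/
def cubeGrid (n k : ℕ) : SimpleGraph (Fin k → Fin n) where
  Adj u v := ∃ i : Fin k,
    ((u i : ℕ) + 1 = (v i : ℕ) ∨ (v i : ℕ) + 1 = (u i : ℕ)) ∧ ∀ j : Fin k, j ≠ i → u j = v j
  symm := ⟨by
    rintro u v ⟨i, h, hj⟩
    exact ⟨i, h.symm, fun j hji => (hj j hji).symm⟩⟩
  loopless := ⟨by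
    rintro u ⟨i, h, -⟩
    omega⟩

/-- A name for one of the `2k` faces of a `k`-dimensional cubical grid: the axis to which the
face is orthogonal, and whether it is the upper (`true`) or the lower (`false`) one of the two
faces orthogonal to that axis. -/
structure CubeFace (k : ℕ) where
  axis : Fin k
  upper : Bool

/-- The set of vertices of the grid `[n]^k` that lie on the face `f`. -/
def CubeFace.verts {k : ℕ} (f : CubeFace k) (n : ℕ) : Set (Fin k → Fin n) :=
  {v | if f.upper then (v f.axis : ℕ) + 1 = n else (v f.axis : ℕ) = 0}

/-- The center `[d]^(k-1)` area of the face `f` of the grid `[c * d]^k`, for odd `c`: every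
coordinate other than the one orthogonal to the face ranges over the `d` middle values
`(c-1)/2 * d, …, (c+1)/2 * d - 1` of `{0, …, c * d - 1}` (written without division). -/
def CubeFace.center {k : ℕ} (f : CubeFace k) (c d : ℕ) : Set (Fin k → Fin (c * d)) :=
  {v | v ∈ f.verts (c * d) ∧
    ∀ j : Fin k, j ≠ f.axis → c * d ≤ 2 * (v j : ℕ) + d ∧ 2 * (v j : ℕ) < c * d + d}

/-- `P₁` and `P₂` are connected by `|P₁|` vertex-disjoint paths of `G`: there are a bijection
from `P₁` to `P₂` and, for each point of `P₁`, a path of `G` from it to its partner, such that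
no two of these paths share a vertex. -/
def SimpleGraph.VertexDisjointlyLinked {V : Type*} (G : SimpleGraph V) (P₁ P₂ : Finset V) :
    Prop :=
  ∃ (σ : P₁ ≃ P₂) (p : ∀ x : P₁, G.Walk (x : V) (σ x : V)),
    (∀ x, (p x).IsPath) ∧
      ∀ x y, x ≠ y → List.Disjoint (p x).support (p y).support

/-! By Menger's theorem it suffices that every set `S` separating `P₁` from `P₂` has at least `|P₁|`
vertices; this follows by counting, with no path system built by hand. Let `Q` be the middle box of
side `5 * d`. Each point of `P₁` and of `P₂` sends four walks to each point of `Q`. A point of `Q`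
beyond the separator is cut off from `P₁`, any other from `P₂`, so at least `4 * |P₁| * |Q|` walks
meet `S`. If no vertex lies on more than `4 * |Q|` walks, then `|P₁| ≤ |S|`.

The load bound holds because each walk first fans out in a layer of thickness `d` at its own face,
where walks from different points are disjoint (`card_spreadLoad_le_of_low`). Farther in, each of
the two families loads a vertex at most `2 * |Q|` times, by a geometric series
(`card_spreadLoad_le_of_high`). `cubeGrid_vertexDisjointlyLinked` does the counting. -/

/-! ### Menger's theorem from Hall's marriage theorem -/

namespace SimpleGraph
variable {V : Type*} {G : SimpleGraph V}

/-- A walk that follows the iterates of a map moving every vertex to itself or to a neighbour. -/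
theorem exists_walk_iterate (g : V → V) (hg : ∀ u, g u = u ∨ G.Adj u (g u)) (x : V) (n : ℕ) :
    ∃ p : G.Walk x (g^[n] x), ∀ v ∈ p.support, ∃ i ≤ n, v = g^[i] x := by
  induction n with
  | zero => exact ⟨Walk.nil, fun v hv => ⟨0, le_rfl, by simpa using hv⟩⟩
  | succ n ih =>
    obtain ⟨p, hp⟩ := ih
    have hstep : ∃ q : G.Walk (g^[n] x) (g^[n + 1] x),
        ∀ v ∈ q.support, v = g^[n] x ∨ v = g^[n + 1] x := by
      rw [Function.iterate_succ_apply']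
      rcases hg (g^[n] x) with h | h
      · rw [h]
        exact ⟨Walk.nil, fun v hv => Or.inl (by simpa using hv)⟩
      · exact ⟨h.toWalk, fun v hv => by simpa using hv⟩
    obtain ⟨q, hq⟩ := hstep
    refine ⟨p.append q, fun v hv => ?_⟩
    rcases (Walk.mem_support_append_iff _ _).1 hv with h | h
    · obtain ⟨i, hi, rfl⟩ := hp v h
      exact ⟨i, by omega, rfl⟩
    · rcases hq v h with rfl | rfl
      · exact ⟨n, by omega, rfl⟩
      · exact ⟨n + 1, le_rfl, rfl⟩

/-- An injective choice of successors for the vertices outside `B`, with values outside `A`,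
decomposes into vertex-disjoint paths from `A` to `B`. -/
theorem vertexDisjointlyLinked_of_successor [Finite V] {A B : Finset V} (hcard : A.card = B.card)
    (f : {u // u ∉ B} → V) (hf : Function.Injective f) (hfA : ∀ u, f u ∉ A)
    (hadj : ∀ u, f u = u ∨ G.Adj u (f u)) : G.VertexDisjointlyLinked A B := by
  classical
  let g : V → V := fun u => if h : u ∈ B then u else f ⟨u, h⟩
  have hg : ∀ u, g u = u ∨ G.Adj u (g u) := by
    intro u
    by_cases h : u ∈ B
    · simp [g, h]
    · simpa [g, h] using hadj ⟨u, h⟩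
  have hgA : ∀ u ∉ B, g u ∉ A := fun u h => by simpa [g, h] using hfA ⟨u, h⟩
  have hginj : ∀ u ∉ B, ∀ v ∉ B, g u = g v → u = v := by
    intro u hu v hv h
    have : f ⟨u, hu⟩ = f ⟨v, hv⟩ := by simpa [g, hu, hv] using h
    simpa using hf this
  -- Coinciding orbit points can be traced back by injectivity until one of them is a starting
  -- point; since `g` takes no value in `A` outside `B`, both are. By finiteness every orbit from
  -- `A` then reaches `B`.
  have key : ∀ i j : ℕ, ∀ x ∈ A, ∀ y ∈ A, (∀ l < i, g^[l] x ∉ B) → (∀ l < j, g^[l] y ∉ B) →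
      g^[i] x = g^[j] y → i = j ∧ x = y := by
    intro i
    induction i with
    | zero =>
      rintro (_ | j) x hx y hy - hj h
      · exact ⟨rfl, h⟩
      · rw [Function.iterate_succ_apply'] at h
        exact absurd (h ▸ hx) (hgA _ (hj j (by omega)))
    | succ i ih =>
      rintro (_ | j) x hx y hy hi hj h
      · rw [Function.iterate_succ_apply'] at h
        exact absurd (h.symm ▸ hy) (hgA _ (hi i (by omega)))
      · rw [Function.iterate_succ_apply', Function.iterate_succ_apply'] at h
        obtain ⟨rfl, rfl⟩ := ih j x hx y hy (fun l hl => hi l (by omega))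
          (fun l hl => hj l (by omega)) (hginj _ (hi i (by omega)) _ (hj j (by omega)) h)
        exact ⟨rfl, rfl⟩
  have hreach : ∀ x ∈ A, ∃ n, g^[n] x ∈ B := by
    intro x hx
    by_contra! hn
    exact not_injective_infinite_finite (fun n : ℕ => g^[n] x) fun i j h =>
      (key i j x hx x hx (fun l _ => hn l) (fun l _ => hn l) h).1
  let N : A → ℕ := fun x => Nat.find (hreach x x.2)
  have hNB : ∀ x : A, g^[N x] (x : V) ∈ B := fun x => Nat.find_spec (hreach x x.2)
  have hNlt : ∀ x : A, ∀ l < N x, g^[l] (x : V) ∉ B := fun x l hl =>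
    Nat.find_min (hreach x x.2) hl
  have hdisj : ∀ x y : A, ∀ i ≤ N x, ∀ j ≤ N y, g^[i] (x : V) = g^[j] (y : V) → x = y :=
    fun x y i hi j hj h => Subtype.ext (key i j x x.2 y y.2
      (fun l hl => hNlt x l (by omega)) (fun l hl => hNlt y l (by omega)) h).2
  let τ : A → B := fun x => ⟨g^[N x] (x : V), hNB x⟩
  have hτ : Function.Bijective τ := by
    rw [Fintype.bijective_iff_injective_and_card]
    refine ⟨fun x y h => hdisj x y _ le_rfl _ le_rfl (congrArg Subtype.val h), by simpa⟩
  choose p hp using fun x : A => exists_walk_iterate (G := G) g hg (x : V) (N x)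
  refine ⟨Equiv.ofBijective τ hτ, fun x => (p x).bypass, fun x => (p x).bypass_isPath, ?_⟩
  intro x y hxy v hvx hvy
  obtain ⟨i, hi, h₁⟩ := hp x v ((p x).support_bypass_subset_support hvx)
  obtain ⟨j, hj, h₂⟩ := hp y v ((p y).support_bypass_subset_support hvy)
  exact hxy (hdisj x y i hi j hj (h₁.symm.trans h₂))

/-- Menger's theorem for two vertex sets of equal size: they are linked if every separator `S`,
given with the part `W` of the graph that it cuts off, is at least as large. -/
theorem vertexDisjointlyLinked_of_forall_separator [Fintype V] {A B : Finset V}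
    (hcard : A.card = B.card)
    (h : ∀ W S : Finset V, (∀ u ∈ W, ∀ v, G.Adj u v → v ∉ S → v ∈ W) →
      (∀ x ∈ A, x ∉ S → x ∈ W) → (∀ y ∈ B, y ∉ W) → A.card ≤ S.card) :
    G.VertexDisjointlyLinked A B := by
  classical
  -- A vertex matched to itself is one that no path uses.
  let t : {u // u ∉ B} → Finset V := fun u =>
    Finset.univ.filter fun v => (v = u ∨ G.Adj u v) ∧ v ∉ A
  have hall : ∀ s : Finset {u // u ∉ B}, s.card ≤ (s.biUnion t).card := by
    intro s
    let W : Finset V := s.map (Function.Embedding.subtype _)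
    let S : Finset V := (A \ W) ∪ (s.biUnion t \ W)
    have hW : ∀ u, u ∈ W ↔ ∃ h : u ∉ B, ⟨u, h⟩ ∈ s := by simp [W]
    have hS : A.card ≤ S.card := by
      refine h W S ?_ ?_ ?_
      · intro u hu v huv hv
        obtain ⟨hB, hs⟩ := (hW u).1 hu
        by_contra hvW
        apply hv
        by_cases hvA : v ∈ A
        · exact Finset.mem_union_left _ (Finset.mem_sdiff.2 ⟨hvA, hvW⟩)
        · refine Finset.mem_union_right _ (Finset.mem_sdiff.2 ⟨?_, hvW⟩)
          exact Finset.mem_biUnion.2 ⟨_, hs, by simp [t, huv, hvA]⟩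
      · intro x hx hxS
        by_contra hxW
        exact hxS (Finset.mem_union_left _ (Finset.mem_sdiff.2 ⟨hx, hxW⟩))
      · intro y hy hyW
        exact ((hW y).1 hyW).1 hy
    -- Every vertex outside `A` is its own candidate, so the candidates include `W \ A` besides
    -- those outside `W`. With `|A| ≤ |S|` this gives Hall's inequality.
    have hsub : W \ A ⊆ s.biUnion t := by
      intro u hu
      obtain ⟨huW, huA⟩ := Finset.mem_sdiff.1 hu
      obtain ⟨hB, hs⟩ := (hW u).1 huW
      exact Finset.mem_biUnion.2 ⟨_, hs, by simp [t, huA]⟩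
    have h₁ : (s.biUnion t \ W).card + (W \ A).card ≤ (s.biUnion t).card := by
      rw [← Finset.card_union_of_disjoint]
      · exact Finset.card_le_card (Finset.union_subset Finset.sdiff_subset hsub)
      · exact Finset.disjoint_left.2 fun a ha hb =>
          (Finset.mem_sdiff.1 ha).2 (Finset.mem_sdiff.1 hb).1
    have h₂ : S.card ≤ (A \ W).card + (s.biUnion t \ W).card := Finset.card_union_le _ _
    have h₃ : (A \ W).card + (A ∩ W).card = A.card := Finset.card_sdiff_add_card_inter _ _
    have h₄ : (W \ A).card + (W ∩ A).card = W.card := Finset.card_sdiff_add_card_inter _ _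
    have h₅ : W.card = s.card := Finset.card_map _
    rw [Finset.inter_comm] at h₄
    omega
  obtain ⟨f, hf, hft⟩ := (Finset.all_card_le_biUnion_card_iff_exists_injective t).1 hall
  have hft' : ∀ u, (f u = u ∨ G.Adj u (f u)) ∧ f u ∉ A := fun u => by simpa [t] using hft u
  exact vertexDisjointlyLinked_of_successor hcard f hf (fun u => (hft' u).2) fun u => (hft' u).1

/-- A walk that avoids `S` cannot leave a set closed under steps outside `S`. -/
theorem Walk.mem_of_disjoint_support {W S : Finset V}
    (hW : ∀ u ∈ W, ∀ v, G.Adj u v → v ∉ S → v ∈ W) {u v : V} (p : G.Walk u v)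
    (hu : u ∈ W) (hp : ∀ x ∈ p.support, x ∉ S) : v ∈ W := by
  induction p with
  | nil => exact hu
  | cons h p ih =>
    exact ih (hW _ hu _ h (hp _ (by simp))) fun x hx => hp x (by simp [hx])

end SimpleGraph

/-! ### Segments and staircases in the grid -/

/-- Two grid points that differ in at most one coordinate `l` are joined by the straight segment. -/
theorem cubeGrid_exists_segment {N k : ℕ} (u w : Fin k → Fin N) (l : Fin k)
    (h : ∀ j, j ≠ l → u j = w j) :
    ∃ p : (cubeGrid N k).Walk u w, ∀ v ∈ p.support, (∀ j, j ≠ l → v j = w j) ∧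
      min (u l : ℕ) (w l) ≤ v l ∧ (v l : ℕ) ≤ max (u l : ℕ) (w l) := by
  have main : ∀ m : ℕ, ∀ u w : Fin k → Fin N, (∀ j, j ≠ l → u j = w j) →
      (u l : ℕ) + m = w l → ∃ p : (cubeGrid N k).Walk u w, ∀ v ∈ p.support,
        (∀ j, j ≠ l → v j = w j) ∧ (u l : ℕ) ≤ v l ∧ (v l : ℕ) ≤ w l := by
    intro m
    induction m with
    | zero =>
      intro u w h hm
      obtain rfl : u = w := by
        funext j
        by_cases hj : j = l
        · subst hj
          exact Fin.ext (by omega)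
        · exact h j hj
      refine ⟨SimpleGraph.Walk.nil, fun v hv => ?_⟩
      obtain rfl : v = u := by simpa using hv
      simp
    | succ m ih =>
      intro u w h hm
      have hlt : (u l : ℕ) + 1 < N := by have := (w l).isLt; omega
      let u' : Fin k → Fin N := Function.update u l ⟨u l + 1, hlt⟩
      have hul : (u' l : ℕ) = u l + 1 := by simp [u']
      have huj : ∀ j, j ≠ l → u' j = u j := fun j hj => by simp [u', hj]
      obtain ⟨p, hp⟩ := ih u' w (fun j hj => (huj j hj).trans (h j hj)) (by omega)
      have hadj : (cubeGrid N k).Adj u u' :=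
        ⟨l, Or.inl hul.symm, fun j hj => (huj j hj).symm⟩
      refine ⟨SimpleGraph.Walk.cons hadj p, fun v hv => ?_⟩
      rcases List.mem_cons.1 (by simpa using hv) with rfl | hv
      · exact ⟨h, le_rfl, by omega⟩
      · obtain ⟨h₁, h₂, h₃⟩ := hp v hv
        exact ⟨h₁, by omega, h₃⟩
  rcases le_total (u l : ℕ) (w l) with hle | hle
  · obtain ⟨p, hp⟩ := main (w l - u l) u w h (by omega)
    exact ⟨p, fun v hv => by have := hp v hv; exact ⟨this.1, by omega, by omega⟩⟩
  · obtain ⟨p, hp⟩ := main (u l - w l) w u (fun j hj => (h j hj).symm) (by omega)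
    refine ⟨p.reverse, fun v hv => ?_⟩
    have := hp v (by simpa using hv)
    exact ⟨fun j hj => (this.1 j hj).trans (h j hj), by omega, by omega⟩

/-- Changing the coordinates of a grid point `u` one after the other, in increasing order, to those
of `z` traces out a walk. -/
theorem cubeGrid_exists_staircase {N k : ℕ} (u z : Fin k → Fin N) :
    ∃ p : (cubeGrid N k).Walk u z, ∀ v ∈ p.support, v = u ∨ ∃ j : Fin k,
      (∀ l < j, v l = z l) ∧ (∀ l, j < l → v l = u l) ∧
        min (u j : ℕ) (z j) ≤ v j ∧ (v j : ℕ) ≤ max (u j : ℕ) (z j) := by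
  let w : ℕ → Fin k → Fin N := fun m l => if (l : ℕ) < m then z l else u l
  have main : ∀ m ≤ k, ∃ p : (cubeGrid N k).Walk u (w m), ∀ v ∈ p.support, v = u ∨ ∃ j : Fin k,
      (∀ l < j, v l = z l) ∧ (∀ l, j < l → v l = u l) ∧
        min (u j : ℕ) (z j) ≤ v j ∧ (v j : ℕ) ≤ max (u j : ℕ) (z j) := by
    intro m
    induction m with
    | zero =>
      intro _
      have hw : w 0 = u := by funext l; simp [w]
      rw [hw]
      exact ⟨SimpleGraph.Walk.nil, fun v hv => Or.inl (by simpa using hv)⟩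
    | succ m ih =>
      intro hm
      obtain ⟨p, hp⟩ := ih (by omega)
      let j : Fin k := ⟨m, by omega⟩
      have hne : ∀ l : Fin k, l ≠ j → (l : ℕ) ≠ m := fun l hl h => hl (Fin.ext h)
      have hwj : ∀ l, l ≠ j → w m l = w (m + 1) l := by
        intro l hl
        have := hne l hl
        have h' : (l : ℕ) < m ↔ (l : ℕ) < m + 1 := by omega
        simp only [w, h']
      have hw₀ : w m j = u j := by simp [w, j]
      have hw₁ : w (m + 1) j = z j := by simp [w, j]
      obtain ⟨q, hq⟩ := cubeGrid_exists_segment (w m) (w (m + 1)) j hwj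
      refine ⟨p.append q, fun v hv => ?_⟩
      rcases (SimpleGraph.Walk.mem_support_append_iff _ _).1 hv with hv | hv
      · exact hp v hv
      · obtain ⟨h₁, h₂, h₃⟩ := hq v hv
        rw [hw₀, hw₁] at h₂ h₃
        refine Or.inr ⟨j, fun l hl => ?_, fun l hl => ?_, h₂, h₃⟩
        · have hl' : (l : ℕ) < m + 1 := by have : (l : ℕ) < m := hl; omega
          rw [h₁ l hl.ne]
          simp [w, hl']
        · have hl' : ¬ (l : ℕ) < m + 1 := by have : m < (l : ℕ) := hl; omega
          rw [h₁ l hl.ne']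
          simp [w, hl']
  have hwk : w k = z := by funext l; simp [w]
  have := main k le_rfl
  rwa [hwk] at this

/-! ### The middle box and the trails that lead to it -/

/-- The box of side `5 * d` in the middle of the grid `[15 * d]^k`. -/
def middleBox (d k : ℕ) : Finset (Fin k → Fin (15 * d)) :=
  Fintype.piFinset fun _ => Finset.univ.filter fun c => 5 * d ≤ (c : ℕ) ∧ (c : ℕ) < 10 * d

theorem mem_middleBox {d k : ℕ} {z : Fin k → Fin (15 * d)} :
    z ∈ middleBox d k ↔ ∀ l, 5 * d ≤ (z l : ℕ) ∧ (z l : ℕ) < 10 * d := by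
  simp [middleBox, Fintype.mem_piFinset]

theorem Fin.card_filter_le_and_lt {N a b : ℕ} (hb : b ≤ N) :
    (Finset.univ.filter fun c : Fin N => a ≤ (c : ℕ) ∧ (c : ℕ) < b).card = b - a := by
  rw [← Nat.card_Ico, ← Finset.card_map Fin.valEmbedding]
  congr 1
  ext m
  simp only [Finset.mem_map, Finset.mem_filter, Finset.mem_univ, true_and, Fin.valEmbedding_apply,
    Finset.mem_Ico]
  exact ⟨by rintro ⟨c, hc, rfl⟩; exact hc, fun h => ⟨⟨m, by omega⟩, h, rfl⟩⟩

theorem card_middleBox (d k : ℕ) : (middleBox d k).card = (5 * d) ^ k := by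
  rw [middleBox, Fintype.card_piFinset_const, Fin.card_filter_le_and_lt (by omega)]
  congr 1
  omega

/-- The coordinates of the corner point of the trail `spreadTrail d x s z`: on a level depending on
`x₁`, in one of the four columns reserved for `x`. -/
def spreadCoord (d : ℕ) {n : ℕ} (x : Fin (n + 2) → Fin (15 * d)) (s : Fin 4)
    (l : Fin (n + 2)) : ℕ :=
  if l = 0 then 8 * d - 1 - x 1 else if l = 1 then 7 * d + 4 * (x 1 - 7 * d) + s else x l

/-- The vertices `v` used to spread the point `x` of the face `x₀ = 0` over `middleBox`: a walk
rises from `x` along axis `0`, moves along axis `1` to the corner point with the coordinates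
`spreadCoord d x s`, and from there sets the coordinates one by one to those of `z`. -/
def spreadTrail (d : ℕ) {n : ℕ} (x : Fin (n + 2) → Fin (15 * d)) (s : Fin 4)
    (z v : Fin (n + 2) → Fin (15 * d)) : Prop :=
  ((∀ l, l ≠ 0 → v l = x l) ∧ (v 0 : ℕ) ≤ spreadCoord d x s 0) ∨
  ((∀ l, l ≠ 1 → (v l : ℕ) = spreadCoord d x s l) ∧
    (x 1 : ℕ) ≤ v 1 ∧ (v 1 : ℕ) ≤ spreadCoord d x s 1) ∨
  ∃ j : Fin (n + 2), (∀ l < j, v l = z l) ∧ (∀ l, j < l → (v l : ℕ) = spreadCoord d x s l) ∧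
    min (spreadCoord d x s j) (z j) ≤ v j ∧ (v j : ℕ) ≤ max (spreadCoord d x s j) (z j)

theorem spreadCoord_zero (d : ℕ) {n : ℕ} (x : Fin (n + 2) → Fin (15 * d)) (s : Fin 4) :
    spreadCoord d x s 0 = 8 * d - 1 - x 1 := by simp [spreadCoord]

theorem spreadCoord_one (d : ℕ) {n : ℕ} (x : Fin (n + 2) → Fin (15 * d)) (s : Fin 4) :
    spreadCoord d x s 1 = 7 * d + 4 * (x 1 - 7 * d) + s := by simp [spreadCoord]

theorem spreadCoord_of_ne (d : ℕ) {n : ℕ} (x : Fin (n + 2) → Fin (15 * d)) (s : Fin 4)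
    {l : Fin (n + 2)} (h₀ : l ≠ 0) (h₁ : l ≠ 1) : spreadCoord d x s l = x l := by
  simp [spreadCoord, h₀, h₁]

theorem CubeFace.mem_center_lower {n d : ℕ} {x : Fin (n + 2) → Fin (15 * d)} :
    x ∈ (CubeFace.mk (0 : Fin (n + 2)) false).center 15 d ↔
      (x 0 : ℕ) = 0 ∧ ∀ l, l ≠ 0 → 7 * d ≤ (x l : ℕ) ∧ (x l : ℕ) < 8 * d := by
  simp only [CubeFace.center, CubeFace.verts, Set.mem_ofPred_eq, Bool.false_eq_true, if_false]
  refine and_congr Iff.rfl (forall₂_congr fun l _ => ?_)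
  omega

theorem spreadCoord_bounds {n d : ℕ} {x : Fin (n + 2) → Fin (15 * d)} (s : Fin 4)
    (hx : x ∈ (CubeFace.mk (0 : Fin (n + 2)) false).center 15 d) {l : Fin (n + 2)} (hl : l ≠ 0) :
    7 * d ≤ spreadCoord d x s l ∧ spreadCoord d x s l < 11 * d := by
  rw [CubeFace.mem_center_lower] at hx
  have := s.isLt
  by_cases h₁ : l = 1
  · subst h₁
    have := hx.2 1 hl
    rw [spreadCoord_one]
    omega
  · have := hx.2 l hl
    rw [spreadCoord_of_ne d x s hl h₁]
    omega

theorem exists_spread_walk {n d : ℕ} {x z : Fin (n + 2) → Fin (15 * d)} (s : Fin 4)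
    (hx : x ∈ (CubeFace.mk (0 : Fin (n + 2)) false).center 15 d) :
    ∃ p : (cubeGrid (15 * d) (n + 2)).Walk x z, ∀ v ∈ p.support, spreadTrail d x s z v := by
  have hb := fun l (hl : l ≠ 0) => spreadCoord_bounds s hx hl
  have h10 : (1 : Fin (n + 2)) ≠ 0 := by simp
  rw [CubeFace.mem_center_lower] at hx
  have hx1 := hx.2 1 h10
  have h0 := spreadCoord_zero d x s
  have h1 := spreadCoord_one d x s
  have hlt : ∀ l, spreadCoord d x s l < 15 * d := by
    intro l
    by_cases hl : l = 0
    · subst hl; omega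
    · have := hb l hl; omega
  let u : Fin (n + 2) → Fin (15 * d) := fun l => ⟨spreadCoord d x s l, hlt l⟩
  have huv : ∀ l, (u l : ℕ) = spreadCoord d x s l := fun l => rfl
  let y : Fin (n + 2) → Fin (15 * d) := Function.update x 0 (u 0)
  have hy0 : y 0 = u 0 := by simp [y]
  have hyl : ∀ l, l ≠ 0 → y l = x l := fun l hl => by simp [y, hl]
  have hyu : ∀ l, l ≠ 1 → y l = u l := by
    intro l hl
    by_cases h : l = 0
    · rw [h, hy0]
    · rw [hyl l h]
      exact Fin.ext (spreadCoord_of_ne d x s h hl).symm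
  obtain ⟨p, hp⟩ := cubeGrid_exists_segment x y 0 fun l hl => (hyl l hl).symm
  obtain ⟨q, hq⟩ := cubeGrid_exists_segment y u 1 hyu
  obtain ⟨r, hr⟩ := cubeGrid_exists_staircase u z
  refine ⟨p.append (q.append r), fun v hv => ?_⟩
  rw [SimpleGraph.Walk.mem_support_append_iff, SimpleGraph.Walk.mem_support_append_iff] at hv
  rcases hv with hv | hv | hv
  · obtain ⟨h₁, -, h₃⟩ := hp v hv
    rw [hy0, huv, hx.1] at h₃
    exact Or.inl ⟨fun l hl => (h₁ l hl).trans (hyl l hl), by simpa using h₃⟩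
  · obtain ⟨h₁, h₂, h₃⟩ := hq v hv
    rw [hyl 1 h10, huv] at h₂ h₃
    refine Or.inr (Or.inl ⟨fun l hl => by rw [h₁ l hl], by omega, by omega⟩)
  · rcases hr v hv with rfl | ⟨j, h₁, h₂, h₃, h₄⟩
    · exact Or.inr (Or.inl ⟨fun l _ => rfl, by rw [huv]; omega, le_rfl⟩)
    · exact Or.inr (Or.inr ⟨j, h₁, fun l hl => by rw [h₂ l hl], h₃, h₄⟩)

/-- With side `15 * d`, these bounds keep a trail at distance at least `4 * d` from every face but
its own. -/
theorem spreadTrail_bounds {n d : ℕ} {x z v : Fin (n + 2) → Fin (15 * d)} {s : Fin 4}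
    (hx : x ∈ (CubeFace.mk (0 : Fin (n + 2)) false).center 15 d) (hz : z ∈ middleBox d (n + 2))
    (hv : spreadTrail d x s z v) :
    (v 0 : ℕ) < 10 * d ∧ ∀ l, l ≠ 0 → 5 * d ≤ (v l : ℕ) ∧ (v l : ℕ) < 11 * d := by
  have hb := fun l (hl : l ≠ 0) => spreadCoord_bounds s hx hl
  have h10 : (1 : Fin (n + 2)) ≠ 0 := by simp
  rw [CubeFace.mem_center_lower] at hx
  rw [mem_middleBox] at hz
  have hx1 := hx.2 1 h10
  have h0 := spreadCoord_zero d x s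
  rcases hv with ⟨h₁, h₂⟩ | ⟨h₁, h₂, h₃⟩ | ⟨j, h₁, h₂, h₃, h₄⟩
  · refine ⟨by omega, fun l hl => ?_⟩
    have := hx.2 l hl
    rw [h₁ l hl]
    omega
  · refine ⟨by have := h₁ 0 h10.symm; omega, fun l hl => ?_⟩
    have := hb l hl
    by_cases hl1 : l = 1
    · subst hl1; omega
    · rw [h₁ l hl1]; omega
  · have hc : ∀ l, v l = z l ∨ (v l : ℕ) = spreadCoord d x s l ∨
        (min (spreadCoord d x s l) (z l) ≤ v l ∧ (v l : ℕ) ≤ max (spreadCoord d x s l) (z l)) := by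
      intro l
      rcases lt_trichotomy l j with h | rfl | h
      · exact Or.inl (h₁ l h)
      · exact Or.inr (Or.inr ⟨h₃, h₄⟩)
      · exact Or.inr (Or.inl (h₂ l h))
    constructor
    · have := hz 0
      rcases hc 0 with h | h | h
      · rw [h]; omega
      · omega
      · omega
    · intro l hl
      have := hz l
      have := hb l hl
      rcases hc l with h | h | h
      · rw [h]; omega
      · omega
      · omega

/-! ### How many trails pass through a vertex -/

open Classical in
/-- The triples `(x, s, z)` whose trail passes through `v`. -/
noncomputable def spreadLoad (d : ℕ) {n : ℕ} (P : Finset (Fin (n + 2) → Fin (15 * d)))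
    (v : Fin (n + 2) → Fin (15 * d)) :
    Finset ((Fin (n + 2) → Fin (15 * d)) × Fin 4 × (Fin (n + 2) → Fin (15 * d))) :=
  (P ×ˢ Finset.univ ×ˢ middleBox d (n + 2)).filter fun ω => spreadTrail d ω.1 ω.2.1 ω.2.2 v

theorem mem_spreadLoad {n d : ℕ} {P : Finset (Fin (n + 2) → Fin (15 * d))}
    {v : Fin (n + 2) → Fin (15 * d)}
    {ω : (Fin (n + 2) → Fin (15 * d)) × Fin 4 × (Fin (n + 2) → Fin (15 * d))} :
    ω ∈ spreadLoad d P v ↔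
      (ω.1 ∈ P ∧ ω.2.2 ∈ middleBox d (n + 2)) ∧ spreadTrail d ω.1 ω.2.1 ω.2.2 v := by
  simp [spreadLoad]

/-- The box starts at level `5 * d`, so below level `d` the staircase is still moving coordinate
`0`, and the trail stays in the plane of axes `0` and `1` through `x`. -/
theorem spreadTrail_low {n d : ℕ} {x z v : Fin (n + 2) → Fin (15 * d)} {s : Fin 4}
    (hx : x ∈ (CubeFace.mk (0 : Fin (n + 2)) false).center 15 d) (hz : z ∈ middleBox d (n + 2))
    (hv : spreadTrail d x s z v) (hv0 : (v 0 : ℕ) < d) :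
    (∀ l, l ≠ 0 → l ≠ 1 → v l = x l) ∧
      (((v 1 : ℕ) = x 1 ∧ (v 0 : ℕ) ≤ 8 * d - 1 - x 1) ∨
        ((v 0 : ℕ) = 8 * d - 1 - x 1 ∧ (x 1 : ℕ) ≤ v 1 ∧
          (v 1 : ℕ) ≤ 7 * d + 4 * (x 1 - 7 * d) + s) ∨
        ((v 1 : ℕ) = 7 * d + 4 * (x 1 - 7 * d) + s ∧ 8 * d - 1 - (x 1 : ℕ) ≤ v 0)) := by
  have h10 : (1 : Fin (n + 2)) ≠ 0 := by simp
  rw [CubeFace.mem_center_lower] at hx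
  rw [mem_middleBox] at hz
  have hz0 := hz 0
  have hx1 := hx.2 1 h10
  have e0 := spreadCoord_zero d x s
  have e1 := spreadCoord_one d x s
  rcases hv with ⟨h₁, h₂⟩ | ⟨h₁, h₂, h₃⟩ | ⟨j, h₁, h₂, h₃, h₄⟩
  · exact ⟨fun l hl _ => h₁ l hl, Or.inl ⟨by rw [h₁ 1 h10], by omega⟩⟩
  · refine ⟨fun l hl hl1 => Fin.ext ((h₁ l hl1).trans (spreadCoord_of_ne d x s hl hl1)), ?_⟩
    have := h₁ 0 h10.symm
    exact Or.inr (Or.inl (by omega))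
  · by_cases hj : j = 0
    · subst hj
      refine ⟨fun l hl hl1 => Fin.ext ((h₂ l (Fin.pos_iff_ne_zero.2 hl)).trans
        (spreadCoord_of_ne d x s hl hl1)), ?_⟩
      have := h₂ 1 (Fin.pos_iff_ne_zero.2 h10)
      exact Or.inr (Or.inr (by omega))
    · have := h₁ 0 (Fin.pos_iff_ne_zero.2 hj)
      rw [this] at hv0
      omega

/-- Here `v` determines `x`. In one plane put `a = x 1 - 7 * d`: the trail rises in column `a` to
level `d - 1 - a`, shifts to column `4 * a + s` and rises again. A larger `a` turns lower and
farther out, so trails with different `a` do not cross. -/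
theorem card_spreadLoad_le_of_low {n d : ℕ} {P : Finset (Fin (n + 2) → Fin (15 * d))}
    (hP : (P : Set (Fin (n + 2) → Fin (15 * d))) ⊆
      (CubeFace.mk (0 : Fin (n + 2)) false).center 15 d)
    {v : Fin (n + 2) → Fin (15 * d)} (hv : (v 0 : ℕ) < d) :
    (spreadLoad d P v).card ≤ 4 * (middleBox d (n + 2)).card := by
  rcases (spreadLoad d P v).eq_empty_or_nonempty with h | ⟨⟨x, s, z⟩, hω⟩
  · simp [h]
  have hsub : spreadLoad d P v ⊆ {x} ×ˢ Finset.univ ×ˢ middleBox d (n + 2) := by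
    rintro ⟨x', s', z'⟩ hω'
    rw [mem_spreadLoad] at hω hω'
    obtain ⟨⟨hx, hz⟩, ht⟩ := hω
    obtain ⟨⟨hx', hz'⟩, ht'⟩ := hω'
    obtain ⟨h₁, h₂⟩ := spreadTrail_low (hP hx) hz ht hv
    obtain ⟨h₁', h₂'⟩ := spreadTrail_low (hP hx') hz' ht' hv
    have hc := CubeFace.mem_center_lower.1 (hP hx)
    have hc' := CubeFace.mem_center_lower.1 (hP hx')
    have h10 : (1 : Fin (n + 2)) ≠ 0 := by simp
    have b := hc.2 1 h10
    have b' := hc'.2 1 h10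
    have hs := s.isLt
    have hs' := s'.isLt
    have : x' = x := by
      funext l
      by_cases hl : l = 0
      · subst hl
        exact Fin.ext (hc'.1.trans hc.1.symm)
      by_cases hl1 : l = 1
      · subst hl1
        dsimp only at h₂ h₂' b b'
        exact Fin.ext (by omega)
      · exact (h₁' l hl hl1).symm.trans (h₁ l hl hl1)
    simp [this, hz']
  refine (Finset.card_le_card hsub).trans (le_of_eq ?_)
  simp

theorem Fin.prod_univ_ite_lt {k j : ℕ} (hj : j ≤ k) (a b : ℕ) :
    ∏ l : Fin k, (if (l : ℕ) < j then a else b) = a ^ j * b ^ (k - j) := by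
  rw [Fin.prod_univ_eq_prod_range (fun l => if l < j then a else b) k,
    ← Finset.prod_range_mul_prod_Ico _ hj]
  congr 1
  · rw [Finset.prod_congr rfl fun l hl => if_pos (Finset.mem_range.1 hl)]
    simp
  · rw [Finset.prod_congr rfl fun l hl => if_neg (not_lt.2 (Finset.mem_Ico.1 hl).1)]
    simp

/-- The factor `4` counts the columns of a point, and the ratio `5` is the box side over `d`: `4 *
(5 + ⋯ + 5 ^ m) + 5 = 5 ^ (m + 1)`. -/
theorem four_mul_geom_sum_le (d m : ℕ) :
    ∑ j ∈ Finset.range m, 4 * d ^ (j + 1) * (5 * d) ^ (m - j) ≤ (5 * d) ^ (m + 1) := by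
  have hgeom : ∀ m : ℕ, ∑ j ∈ Finset.range m, 4 * 5 ^ (m - j) + 5 = 5 ^ (m + 1) := by
    intro m
    induction m with
    | zero => rfl
    | succ m ih =>
      rw [Finset.sum_range_succ']
      simp only [Nat.add_sub_add_right, Nat.sub_zero]
      rw [pow_succ 5 (m + 1)]
      omega
  calc ∑ j ∈ Finset.range m, 4 * d ^ (j + 1) * (5 * d) ^ (m - j)
      = ∑ j ∈ Finset.range m, d ^ (m + 1) * (4 * 5 ^ (m - j)) := by
        refine Finset.sum_congr rfl fun j hj => ?_
        have : m + 1 = (j + 1) + (m - j) := by have := Finset.mem_range.1 hj; omega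
        rw [mul_pow, this, pow_add]
        ring
    _ = d ^ (m + 1) * ∑ j ∈ Finset.range m, 4 * 5 ^ (m - j) := by rw [Finset.mul_sum]
    _ ≤ d ^ (m + 1) * 5 ^ (m + 1) := Nat.mul_le_mul_left _ (by have := hgeom m; omega)
    _ = (5 * d) ^ (m + 1) := by rw [mul_pow, mul_comm]

/-- While only coordinate `0` of the staircase has moved, `x 1 - 7 * d` and `s` are quotient and
remainder of `v 1 - 7 * d` by `4`, so only `z` is free. The four columns serve to avoid a factor `4`
here. -/
theorem card_spreadLoad_column_le {n d : ℕ} {P : Finset (Fin (n + 2) → Fin (15 * d))}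
    (hP : (P : Set (Fin (n + 2) → Fin (15 * d))) ⊆
      (CubeFace.mk (0 : Fin (n + 2)) false).center 15 d)
    (v : Fin (n + 2) → Fin (15 * d))
    (F : Finset ((Fin (n + 2) → Fin (15 * d)) × Fin 4 × (Fin (n + 2) → Fin (15 * d))))
    (hF : ∀ ω ∈ F, (ω.1 ∈ P ∧ ω.2.2 ∈ middleBox d (n + 2)) ∧
      ∀ l, l ≠ 0 → (v l : ℕ) = spreadCoord d ω.1 ω.2.1 l) :
    F.card ≤ (middleBox d (n + 2)).card := by
  refine Finset.card_le_card_of_injOn (fun ω => ω.2.2) (fun ω hω => (hF ω hω).1.2) ?_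
  rintro ⟨x, s, z⟩ hω ⟨x', s', z'⟩ hω' (rfl : z = z')
  obtain ⟨⟨hx, -⟩, h⟩ := hF _ hω
  obtain ⟨⟨hx', -⟩, h'⟩ := hF _ hω'
  have hc := CubeFace.mem_center_lower.1 (hP hx)
  have hc' := CubeFace.mem_center_lower.1 (hP hx')
  have h10 : (1 : Fin (n + 2)) ≠ 0 := by simp
  have b := hc.2 1 h10
  have b' := hc'.2 1 h10
  have e := (spreadCoord_one d x s).symm.trans ((h 1 h10).symm.trans (h' 1 h10))
  rw [spreadCoord_one] at e
  have hs := s.isLt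
  have hs' := s'.isLt
  dsimp only at e b b'
  obtain rfl : s = s' := Fin.ext (by omega)
  obtain rfl : x = x' := by
    funext l
    by_cases hl : l = 0
    · subst hl
      exact Fin.ext (hc.1.trans hc'.1.symm)
    by_cases hl1 : l = 1
    · subst hl1
      exact Fin.ext (by omega)
    · refine Fin.ext ?_
      have := (h l hl).symm.trans (h' l hl)
      rwa [spreadCoord_of_ne d _ _ hl hl1, spreadCoord_of_ne d _ _ hl hl1] at this
  rfl

/-- While coordinate `j + 1` moves, `v` reveals the earlier coordinates of `z` and the later ones of
`x`. What stays free is `s`, coordinates `1, …, j + 1` of `x` and the last `n + 1 - j` of `z`. -/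
theorem card_spreadLoad_step_le {n d : ℕ} {P : Finset (Fin (n + 2) → Fin (15 * d))}
    (hP : (P : Set (Fin (n + 2) → Fin (15 * d))) ⊆
      (CubeFace.mk (0 : Fin (n + 2)) false).center 15 d)
    (v : Fin (n + 2) → Fin (15 * d)) (j : Fin (n + 1))
    (F : Finset ((Fin (n + 2) → Fin (15 * d)) × Fin 4 × (Fin (n + 2) → Fin (15 * d))))
    (hF : ∀ ω ∈ F, (ω.1 ∈ P ∧ ω.2.2 ∈ middleBox d (n + 2)) ∧ (∀ l < j.succ, v l = ω.2.2 l) ∧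
      ∀ l, j.succ < l → (v l : ℕ) = spreadCoord d ω.1 ω.2.1 l) :
    F.card ≤ 4 * d ^ ((j : ℕ) + 1) * (5 * d) ^ (n + 1 - j) := by
  let X : Fin (n + 2) → Finset (Fin (15 * d)) := Fin.cons
    (Finset.univ.filter fun c => 0 ≤ (c : ℕ) ∧ (c : ℕ) < 1)
    fun l => if (l : ℕ) < j + 1 then
      Finset.univ.filter fun c => 7 * d ≤ (c : ℕ) ∧ (c : ℕ) < 8 * d else {v l.succ}
  let Z : Fin (n + 2) → Finset (Fin (15 * d)) := fun l => if (l : ℕ) < j + 1 then {v l} else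
    Finset.univ.filter fun c => 5 * d ≤ (c : ℕ) ∧ (c : ℕ) < 10 * d
  have hj := j.isLt
  have hX : (Fintype.piFinset X).card ≤ d ^ ((j : ℕ) + 1) := by
    rw [Fintype.card_piFinset, Fin.prod_univ_succ]
    -- Only an inequality, since the grid is empty for `d = 0`.
    have h0 : (X 0).card ≤ 1 := by
      refine Finset.card_le_one.2 fun a ha b hb => Fin.ext ?_
      have ha' := (Finset.mem_filter.1 ha).2
      have hb' := (Finset.mem_filter.1 hb).2
      omega
    have hl : ∀ l : Fin (n + 1), (X l.succ).card = if (l : ℕ) < j + 1 then d else 1 := by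
      intro l
      simp only [X, Fin.cons_succ]
      split_ifs
      · rw [Fin.card_filter_le_and_lt (by omega)]
        omega
      · simp
    rw [Finset.prod_congr rfl fun l _ => hl l, Fin.prod_univ_ite_lt (by omega)]
    simpa using Nat.mul_le_mul_right (d ^ ((j : ℕ) + 1)) h0
  have hZ : (Fintype.piFinset Z).card = (5 * d) ^ (n + 1 - j) := by
    rw [Fintype.card_piFinset]
    have hl : ∀ l : Fin (n + 2), (Z l).card = if (l : ℕ) < j + 1 then 1 else 5 * d := by
      intro l
      simp only [Z]
      split_ifs
      · simp
      · rw [Fin.card_filter_le_and_lt (by omega)]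
        omega
    rw [Finset.prod_congr rfl fun l _ => hl l, Fin.prod_univ_ite_lt (by omega), one_pow, one_mul]
    congr 1
    omega
  have hsub : F ⊆ Fintype.piFinset X ×ˢ Finset.univ ×ˢ Fintype.piFinset Z := by
    rintro ⟨x, s, z⟩ hω
    obtain ⟨⟨hx, hz⟩, h₁, h₂⟩ := hF _ hω
    have hc := CubeFace.mem_center_lower.1 (hP hx)
    have hz := mem_middleBox.1 hz
    simp only [Finset.mem_product, Fintype.mem_piFinset, Finset.mem_univ, true_and]
    dsimp only at hc hz h₁ h₂
    constructor
    · refine Fin.cases ?_ fun l => ?_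
      · simp [X, hc.1]
      · simp only [X, Fin.cons_succ]
        split_ifs with hl
        · simpa using hc.2 _ (Fin.succ_ne_zero l)
        · have hlt : j.succ < l.succ := by
            rw [Fin.succ_lt_succ_iff, Fin.lt_def]
            omega
          have hne : l.succ ≠ 1 := by
            intro h
            obtain rfl : l = 0 := Fin.succ_injective _ (h.trans Fin.succ_zero_eq_one.symm)
            simp at hl
          refine Finset.mem_singleton.2 (Fin.ext ?_)
          rw [h₂ _ hlt, spreadCoord_of_ne d x s (Fin.succ_ne_zero l) hne]
    · intro l
      simp only [Z]
      split_ifs with hl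
      · exact Finset.mem_singleton.2 (h₁ l (by rw [Fin.lt_def]; simpa using hl)).symm
      · simpa using hz l
  calc F.card ≤ _ := Finset.card_le_card hsub
    _ = (Fintype.piFinset X).card * (4 * (Fintype.piFinset Z).card) := by
      simp [Finset.card_product]
    _ ≤ d ^ ((j : ℕ) + 1) * (4 * (5 * d) ^ (n + 1 - j)) := by rw [hZ]; gcongr
    _ = _ := by ring

/-- The initial rise and shift stay below level `d`, so only the staircase counts: its first leg
contributes at most one box, all later legs together at most another. -/
theorem card_spreadLoad_le_of_high {n d : ℕ} {P : Finset (Fin (n + 2) → Fin (15 * d))}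
    (hP : (P : Set (Fin (n + 2) → Fin (15 * d))) ⊆
      (CubeFace.mk (0 : Fin (n + 2)) false).center 15 d)
    {v : Fin (n + 2) → Fin (15 * d)} (hv : d ≤ (v 0 : ℕ)) :
    (spreadLoad d P v).card ≤ 2 * (middleBox d (n + 2)).card := by
  classical
  let F₀ := (spreadLoad d P v).filter fun ω => ∀ l, l ≠ 0 → (v l : ℕ) = spreadCoord d ω.1 ω.2.1 l
  let F : Fin (n + 1) → Finset _ := fun j => (spreadLoad d P v).filter fun ω =>
    (∀ l < j.succ, v l = ω.2.2 l) ∧ ∀ l, j.succ < l → (v l : ℕ) = spreadCoord d ω.1 ω.2.1 l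
  have hsub : spreadLoad d P v ⊆ F₀ ∪ Finset.univ.biUnion F := by
    rintro ⟨x, s, z⟩ hω
    obtain ⟨⟨hx, hz⟩, ht⟩ := mem_spreadLoad.1 hω
    have hc := CubeFace.mem_center_lower.1 (hP hx)
    have h10 : (1 : Fin (n + 2)) ≠ 0 := by simp
    have b := hc.2 1 h10
    have e0 := spreadCoord_zero d x s
    dsimp only at b
    rcases ht with ⟨-, h₂⟩ | ⟨h₁, -⟩ | ⟨j, h₁, h₂, -⟩
    · dsimp only at h₂
      omega
    · have := h₁ 0 h10.symm
      dsimp only at this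
      omega
    · induction j using Fin.cases with
      | zero =>
        exact Finset.mem_union_left _ (Finset.mem_filter.2
          ⟨hω, fun l hl => h₂ l (Fin.pos_iff_ne_zero.2 hl)⟩)
      | succ j =>
        exact Finset.mem_union_right _ (Finset.mem_biUnion.2
          ⟨j, Finset.mem_univ _, Finset.mem_filter.2 ⟨hω, h₁, h₂⟩⟩)
  have h₀ : F₀.card ≤ (middleBox d (n + 2)).card :=
    card_spreadLoad_column_le hP v F₀ fun ω hω =>
      ⟨(mem_spreadLoad.1 (Finset.mem_filter.1 hω).1).1, (Finset.mem_filter.1 hω).2⟩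
  have h₁ : (Finset.univ.biUnion F).card ≤ (middleBox d (n + 2)).card := by
    calc (Finset.univ.biUnion F).card ≤ ∑ j, (F j).card := Finset.card_biUnion_le
      _ ≤ ∑ j : Fin (n + 1), 4 * d ^ ((j : ℕ) + 1) * (5 * d) ^ (n + 1 - j) :=
        Finset.sum_le_sum fun j _ => card_spreadLoad_step_le hP v j (F j) fun ω hω =>
          ⟨(mem_spreadLoad.1 (Finset.mem_filter.1 hω).1).1, (Finset.mem_filter.1 hω).2⟩
      _ = ∑ j ∈ Finset.range (n + 1), 4 * d ^ (j + 1) * (5 * d) ^ (n + 1 - j) :=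
        Fin.sum_univ_eq_sum_range (fun j => 4 * d ^ (j + 1) * (5 * d) ^ (n + 1 - j)) (n + 1)
      _ ≤ (5 * d) ^ (n + 1 + 1) := four_mul_geom_sum_le d (n + 1)
      _ = (middleBox d (n + 2)).card := (card_middleBox d (n + 2)).symm
  have := (Finset.card_le_card hsub).trans (Finset.card_union_le _ _)
  omega

/-! ### Symmetries of the grid and transfer to an arbitrary face -/

/-- The graph isomorphism of the grid that permutes the axes by `e` and then, if `r` holds, reverses
the coordinate on axis `a`. -/
def cubeGridIso (N k : ℕ) (e : Equiv.Perm (Fin k)) (a : Fin k) (r : Bool) :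
    cubeGrid N k ≃g cubeGrid N k where
  toFun v l := if l = a ∧ r = true then Fin.rev (v (e l)) else v (e l)
  invFun w m := if e.symm m = a ∧ r = true then Fin.rev (w (e.symm m)) else w (e.symm m)
  left_inv v := by
    funext m
    by_cases h : e.symm m = a ∧ r = true
    · simp [h, show e a = m by rw [← h.1, e.apply_symm_apply]]
    · simp [h]
  right_inv w := by
    funext l
    by_cases h : l = a ∧ r = true <;> simp [h]
  map_rel_iff' := by
    intro u v
    constructor
    · rintro ⟨l, h, hl⟩
      refine ⟨e l, ?_, fun j hj => ?_⟩
      · have h₁ := (u (e l)).isLt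
        have h₂ := (v (e l)).isLt
        by_cases hc : l = a ∧ r = true
        · simp only [Equiv.coe_fn_mk, hc, and_self, if_true, Fin.val_rev] at h h₁ h₂ ⊢
          omega
        · simpa only [Equiv.coe_fn_mk, hc, if_false] using h
      · have hne : e.symm j ≠ l := fun h' => hj (by rw [← h', e.apply_symm_apply])
        have := hl _ hne
        by_cases hc : e.symm j = a ∧ r = true
        · simpa [hc, show e a = j by rw [← hc.1, e.apply_symm_apply]] using this
        · simpa [hc] using this
    · rintro ⟨m, h, hm⟩
      refine ⟨e.symm m, ?_, fun j hj => ?_⟩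
      · have h₁ := (u m).isLt
        have h₂ := (v m).isLt
        by_cases hc : e.symm m = a ∧ r = true
        · simp only [Equiv.coe_fn_mk, hc, and_self, if_true, Fin.val_rev]
          rw [← hc.1, e.apply_symm_apply]
          omega
        · simpa only [Equiv.coe_fn_mk, hc, if_false, e.apply_symm_apply] using h
      · have := hm (e j) fun h' => hj (by rw [← h', e.symm_apply_apply])
        simp only [Equiv.coe_fn_mk, this]

theorem cubeGridIso_apply (N k : ℕ) (e : Equiv.Perm (Fin k)) (a : Fin k) (r : Bool)
    (v : Fin k → Fin N) (l : Fin k) :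
    cubeGridIso N k e a r v l = if l = a ∧ r = true then Fin.rev (v (e l)) else v (e l) := rfl

/-- The isomorphism that carries the face `f` to the lower face of axis `0`. -/
def CubeFace.normalize {n : ℕ} (f : CubeFace (n + 1)) (N : ℕ) :
    cubeGrid N (n + 1) ≃g cubeGrid N (n + 1) :=
  cubeGridIso N (n + 1) (Equiv.swap 0 f.axis) 0 f.upper

/-- Coordinate `0` of the normalized point is thus the distance of `v` from `f`. -/
theorem CubeFace.normalize_zero {n N : ℕ} (f : CubeFace (n + 1)) (v : Fin (n + 1) → Fin N) :
    (f.normalize N v 0 : ℕ) = if f.upper then N - 1 - v f.axis else v f.axis := by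
  rw [normalize, cubeGridIso_apply, Equiv.swap_apply_left]
  cases f.upper <;> simp [Fin.val_rev]
  omega

theorem CubeFace.normalize_of_ne {n N : ℕ} (f : CubeFace (n + 1)) (v : Fin (n + 1) → Fin N)
    {l : Fin (n + 1)} (hl : l ≠ 0) : f.normalize N v l = v (Equiv.swap 0 f.axis l) := by
  rw [normalize, cubeGridIso_apply, if_neg fun h => hl h.1]

theorem Equiv.swap_apply_ne_right {α : Type*} [DecidableEq α] {a b c : α} (h : c ≠ a) :
    Equiv.swap a b c ≠ b := by
  intro h'
  exact h ((Equiv.swap a b).injective (h'.trans (Equiv.swap_apply_left a b).symm))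

theorem CubeFace.normalize_mem_center {n d : ℕ} (f : CubeFace (n + 2))
    {v : Fin (n + 2) → Fin (15 * d)} (hv : v ∈ f.center 15 d) :
    f.normalize (15 * d) v ∈ (CubeFace.mk (0 : Fin (n + 2)) false).center 15 d := by
  rw [CubeFace.mem_center_lower]
  obtain ⟨hv₁, hv₂⟩ := hv
  constructor
  · rw [f.normalize_zero]
    simp only [CubeFace.verts, Set.mem_ofPred_eq] at hv₁
    cases h : f.upper <;> simp only [h] at hv₁ ⊢
    · simpa using hv₁
    · simp only [if_true] at hv₁ ⊢
      omega
  · intro l hl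
    rw [f.normalize_of_ne v hl]
    have := hv₂ _ (Equiv.swap_apply_ne_right (b := f.axis) hl)
    omega

theorem CubeFace.normalize_mem_middleBox {n d : ℕ} (f : CubeFace (n + 2))
    {v : Fin (n + 2) → Fin (15 * d)} (hv : v ∈ middleBox d (n + 2)) :
    f.normalize (15 * d) v ∈ middleBox d (n + 2) := by
  rw [mem_middleBox] at hv ⊢
  intro l
  by_cases hl : l = 0
  · subst hl
    have := hv f.axis
    rw [f.normalize_zero]
    split_ifs <;> omega
  · rw [f.normalize_of_ne v hl]
    exact hv _

/-- The sets `T x s z` carry walks that spread the points of `P` over `middleBox`, such that no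
vertex near a face other than `f` is covered, and no vertex is covered too often. -/
structure IsSpread {n d : ℕ} (f : CubeFace (n + 2)) (P : Finset (Fin (n + 2) → Fin (15 * d)))
    (T : (Fin (n + 2) → Fin (15 * d)) → Fin 4 → (Fin (n + 2) → Fin (15 * d)) →
      Set (Fin (n + 2) → Fin (15 * d))) : Prop where
  exists_walk : ∀ x ∈ P, ∀ s, ∀ z, ∃ p : (cubeGrid (15 * d) (n + 2)).Walk x z,
    ∀ v ∈ p.support, v ∈ T x s z
  not_near : ∀ x ∈ P, ∀ s, ∀ z ∈ middleBox d (n + 2), ∀ v ∈ T x s z, ∀ g : CubeFace (n + 2),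
    g ≠ f → d ≤ (g.normalize (15 * d) v 0 : ℕ)
  card_le_of_near : ∀ v, (f.normalize (15 * d) v 0 : ℕ) < d →
    {ω : _ × Fin 4 × _ | (ω.1 ∈ P ∧ ω.2.2 ∈ middleBox d (n + 2)) ∧ v ∈ T ω.1 ω.2.1 ω.2.2}.ncard ≤
      4 * (middleBox d (n + 2)).card
  card_le_of_far : ∀ v, d ≤ (f.normalize (15 * d) v 0 : ℕ) →
    {ω : _ × Fin 4 × _ | (ω.1 ∈ P ∧ ω.2.2 ∈ middleBox d (n + 2)) ∧ v ∈ T ω.1 ω.2.1 ω.2.2}.ncard ≤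
      2 * (middleBox d (n + 2)).card

theorem CubeFace.exists_isSpread {n d : ℕ} (f : CubeFace (n + 2))
    {P : Finset (Fin (n + 2) → Fin (15 * d))}
    (hP : (P : Set (Fin (n + 2) → Fin (15 * d))) ⊆ f.center 15 d) :
    ∃ T, IsSpread f P T := by
  let φ := f.normalize (15 * d)
  let P' : Finset (Fin (n + 2) → Fin (15 * d)) := P.map φ.toEquiv.toEmbedding
  have hP' : (P' : Set (Fin (n + 2) → Fin (15 * d))) ⊆
      (CubeFace.mk (0 : Fin (n + 2)) false).center 15 d := by
    intro w hw
    obtain ⟨x, hx, rfl⟩ := Finset.mem_map.1 hw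
    exact f.normalize_mem_center (hP hx)
  let T : (Fin (n + 2) → Fin (15 * d)) → Fin 4 → (Fin (n + 2) → Fin (15 * d)) →
      Set (Fin (n + 2) → Fin (15 * d)) := fun x s z => {v | spreadTrail d (φ x) s (φ z) (φ v)}
  have hcard : ∀ v, {ω : _ × Fin 4 × _ | (ω.1 ∈ P ∧ ω.2.2 ∈ middleBox d (n + 2)) ∧
      v ∈ T ω.1 ω.2.1 ω.2.2}.ncard ≤ (spreadLoad d P' (φ v)).card := by
    intro v
    rw [← Set.ncard_coe_finset]
    refine Set.ncard_le_ncard_of_injOn (fun ω => (φ ω.1, ω.2.1, φ ω.2.2)) ?_ ?_ (Finset.finite_toSet _)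
    · rintro ⟨x, s, z⟩ ⟨⟨hx, hz⟩, hv⟩
      exact Finset.mem_coe.2 (mem_spreadLoad.2
        ⟨⟨Finset.mem_map_of_mem _ hx, f.normalize_mem_middleBox hz⟩, hv⟩)
    · rintro ⟨x, s, z⟩ - ⟨x', s', z'⟩ - h
      simpa using h
  refine ⟨T, ?_, ?_, fun v hv => (hcard v).trans (card_spreadLoad_le_of_low hP' hv),
    fun v hv => (hcard v).trans (card_spreadLoad_le_of_high hP' hv)⟩
  · intro x hx s z
    obtain ⟨p, hp⟩ := exists_spread_walk (z := φ z) s (f.normalize_mem_center (hP hx))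
    refine ⟨(p.map φ.symm.toHom).copy (φ.symm_apply_apply x) (φ.symm_apply_apply z), ?_⟩
    intro v hv
    rw [SimpleGraph.Walk.support_copy, SimpleGraph.Walk.support_map, List.mem_map] at hv
    obtain ⟨w, hw, rfl⟩ := hv
    change spreadTrail d (φ x) s (φ z) (φ (φ.symm w))
    rw [φ.apply_symm_apply]
    exact hp w hw
  · intro x hx s z hz v hv g hg
    obtain ⟨h₁, h₂⟩ := spreadTrail_bounds (f.normalize_mem_center (hP hx))
      (f.normalize_mem_middleBox hz) hv
    change (f.normalize (15 * d) v 0 : ℕ) < 10 * d at h₁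
    rw [f.normalize_zero] at h₁
    rw [g.normalize_zero]
    -- The opposite face is kept away by the bound on coordinate `0`, the faces of other axes by the
    -- bounds on the remaining coordinates.
    by_cases haxis : g.axis = f.axis
    · have hup : g.upper ≠ f.upper := by
        intro hup
        exact hg (by cases g; cases f; simp_all)
      have := (v f.axis).isLt
      rw [haxis]
      cases hfu : f.upper <;> cases hgu : g.upper <;> simp only [hfu, hgu] at h₁ hup ⊢
      · exact absurd rfl hup
      · simp at h₁ ⊢
        omega
      · simp at h₁ ⊢
        omega
      · exact absurd rfl hup
    · have hne : Equiv.swap 0 f.axis g.axis ≠ 0 := by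
        intro h
        exact haxis ((Equiv.swap 0 f.axis).injective (h.trans (Equiv.swap_apply_right 0 f.axis).symm))
      have h₃ := h₂ _ hne
      change 5 * d ≤ (f.normalize (15 * d) v _ : ℕ) ∧ (f.normalize (15 * d) v _ : ℕ) < _ at h₃
      rw [f.normalize_of_ne v hne, Equiv.swap_apply_self] at h₃
      split_ifs <;> omega

/-! ### Double counting against a separator -/

/-- If every element of `E` is related to an element of `S`, then `E` has at most as many elements
as there are related pairs. -/
theorem card_le_sum_ncard {α β : Type*} [Finite β] (S : Finset α) (E : Finset β) (R : β → α → Prop)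
    (hE : ∀ ω ∈ E, ∃ v ∈ S, R ω v) (C : β → Prop) (hC : ∀ ω ∈ E, C ω) :
    E.card ≤ ∑ v ∈ S, {ω | C ω ∧ R ω v}.ncard := by
  classical
  have hsub : (E : Set β) ⊆ ⋃ v ∈ S, {ω | C ω ∧ R ω v} := by
    intro ω hω
    obtain ⟨v, hv, h⟩ := hE ω hω
    exact Set.mem_iUnion₂.2 ⟨v, hv, hC ω hω, h⟩
  rw [← Set.ncard_coe_finset]
  exact (Set.ncard_le_ncard hsub (Set.toFinite _)).trans (Finset.set_ncard_biUnion_le S _)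

theorem cubeGrid_vertexDisjointlyLinked {n d : ℕ} {f₁ f₂ : CubeFace (n + 2)} (hf : f₁ ≠ f₂)
    {P₁ P₂ : Finset (Fin (n + 2) → Fin (15 * d))}
    (h₁ : (P₁ : Set (Fin (n + 2) → Fin (15 * d))) ⊆ f₁.center 15 d)
    (h₂ : (P₂ : Set (Fin (n + 2) → Fin (15 * d))) ⊆ f₂.center 15 d)
    (hcard : P₁.card = P₂.card) :
    (cubeGrid (15 * d) (n + 2)).VertexDisjointlyLinked P₁ P₂ := by
  classical
  -- A point of `P₁` forces `d > 0`, so that `|Q|` can be cancelled at the end.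
  rcases P₁.eq_empty_or_nonempty with hP | ⟨x₀, hx₀⟩
  · subst hP
    exact SimpleGraph.vertexDisjointlyLinked_of_forall_separator hcard fun W S _ _ _ => by simp
  have hd : 0 < d := by
    have := (x₀ 0).isLt
    omega
  refine SimpleGraph.vertexDisjointlyLinked_of_forall_separator hcard fun W S hW hW₁ hW₂ => ?_
  obtain ⟨T₁, hT₁⟩ := f₁.exists_isSpread h₁
  obtain ⟨T₂, hT₂⟩ := f₂.exists_isSpread h₂
  let Q := middleBox d (n + 2)
  have hQ : 0 < Q.card := by rw [card_middleBox]; positivity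
  -- Each box point is used from one side only, the side from which `S` cuts it off.
  let E₁ := P₁ ×ˢ (Finset.univ : Finset (Fin 4)) ×ˢ (Q \ W)
  let E₂ := P₂ ×ˢ (Finset.univ : Finset (Fin 4)) ×ˢ (Q ∩ W)
  have hit₁ : ∀ ω ∈ E₁, ∃ v ∈ S, v ∈ T₁ ω.1 ω.2.1 ω.2.2 := by
    rintro ⟨x, s, z⟩ hω
    simp only [E₁, Finset.mem_product, Finset.mem_univ, true_and, Finset.mem_sdiff] at hω
    obtain ⟨p, hp⟩ := hT₁.exists_walk x hω.1 s z
    by_contra! hS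
    have hp' : ∀ v ∈ p.support, v ∉ S := fun v hv hvS => hS v hvS (hp v hv)
    exact hω.2.2 (p.mem_of_disjoint_support hW (hW₁ x hω.1 (hp' x p.start_mem_support)) hp')
  have hit₂ : ∀ ω ∈ E₂, ∃ v ∈ S, v ∈ T₂ ω.1 ω.2.1 ω.2.2 := by
    rintro ⟨y, s, z⟩ hω
    simp only [E₂, Finset.mem_product, Finset.mem_univ, true_and, Finset.mem_inter] at hω
    obtain ⟨p, hp⟩ := hT₂.exists_walk y hω.1 s z
    by_contra! hS
    refine hW₂ y hω.1 (p.reverse.mem_of_disjoint_support hW hω.2.2 fun v hv hvS => ?_)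
    exact hS v hvS (hp v (by simpa using hv))
  have c₁ := card_le_sum_ncard S E₁ (fun ω v => v ∈ T₁ ω.1 ω.2.1 ω.2.2) hit₁
    (fun ω => ω.1 ∈ P₁ ∧ ω.2.2 ∈ Q) (by
      rintro ⟨x, s, z⟩ hω
      simp only [E₁, Finset.mem_product, Finset.mem_sdiff] at hω
      exact ⟨hω.1, hω.2.2.1⟩)
  have c₂ := card_le_sum_ncard S E₂ (fun ω v => v ∈ T₂ ω.1 ω.2.1 ω.2.2) hit₂
    (fun ω => ω.1 ∈ P₂ ∧ ω.2.2 ∈ Q) (by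
      rintro ⟨x, s, z⟩ hω
      simp only [E₂, Finset.mem_product, Finset.mem_inter] at hω
      exact ⟨hω.1, hω.2.2.1⟩)
  -- Near `f₁` or `f₂` only that face's own family is present, with load at most `4 * |Q|`;
  -- elsewhere the two families add up to `2 * |Q| + 2 * |Q|`.
  have hload : ∀ v, {ω : _ × Fin 4 × _ | (ω.1 ∈ P₁ ∧ ω.2.2 ∈ Q) ∧ v ∈ T₁ ω.1 ω.2.1 ω.2.2}.ncard +
      {ω : _ × Fin 4 × _ | (ω.1 ∈ P₂ ∧ ω.2.2 ∈ Q) ∧ v ∈ T₂ ω.1 ω.2.1 ω.2.2}.ncard ≤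
        4 * Q.card := by
    intro v
    rcases lt_or_ge (f₁.normalize (15 * d) v 0 : ℕ) d with hv₁ | hv₁
    · have h0 : {ω : _ × Fin 4 × _ | (ω.1 ∈ P₂ ∧ ω.2.2 ∈ Q) ∧ v ∈ T₂ ω.1 ω.2.1 ω.2.2} = ∅ := by
        refine Set.eq_empty_of_forall_notMem fun ω hω => ?_
        have := hT₂.not_near _ hω.1.1 _ _ hω.1.2 v hω.2 f₁ hf
        omega
      rw [h0, Set.ncard_empty, add_zero]
      exact hT₁.card_le_of_near v hv₁
    rcases lt_or_ge (f₂.normalize (15 * d) v 0 : ℕ) d with hv₂ | hv₂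
    · have h0 : {ω : _ × Fin 4 × _ | (ω.1 ∈ P₁ ∧ ω.2.2 ∈ Q) ∧ v ∈ T₁ ω.1 ω.2.1 ω.2.2} = ∅ := by
        refine Set.eq_empty_of_forall_notMem fun ω hω => ?_
        have := hT₁.not_near _ hω.1.1 _ _ hω.1.2 v hω.2 f₂ hf.symm
        omega
      rw [h0, Set.ncard_empty, zero_add]
      exact hT₂.card_le_of_near v hv₂
    · have e₁ := hT₁.card_le_of_far v hv₁
      have e₂ := hT₂.card_le_of_far v hv₂
      exact (add_le_add e₁ e₂).trans (by change 2 * Q.card + 2 * Q.card ≤ _; omega)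
  have hE : E₁.card + E₂.card = P₁.card * (4 * Q.card) := by
    simp only [E₁, E₂, Finset.card_product, Finset.card_univ, Fintype.card_fin, ← hcard]
    rw [← mul_add, ← mul_add, Finset.card_sdiff_add_card_inter]
  have hS : P₁.card * (4 * Q.card) ≤ S.card * (4 * Q.card) := by
    rw [← hE]
    refine (add_le_add c₁ c₂).trans ?_
    rw [← Finset.sum_add_distrib]
    exact (Finset.sum_le_card_nsmul S _ _ fun v _ => hload v).trans (by simp)
  exact Nat.le_of_mul_le_mul_right hS (by omega)

theorem CubeFace.subsingleton_verts_one (f : CubeFace 1) (N : ℕ) : (f.verts N).Subsingleton := by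
  intro u hu v hv
  funext j
  obtain rfl : j = f.axis := Subsingleton.elim _ _
  simp only [CubeFace.verts, Set.mem_ofPred_eq] at hu hv
  refine Fin.ext ?_
  split_ifs at hu hv <;> omega

theorem mainTheorem7 (k d : ℕ) (f₁ f₂ : CubeFace k) (hf : f₁ ≠ f₂)
    (P₁ P₂ : Finset (Fin k → Fin (15 * d)))
    (h₁ : (P₁ : Set (Fin k → Fin (15 * d))) ⊆ f₁.center 15 d)
    (h₂ : (P₂ : Set (Fin k → Fin (15 * d))) ⊆ f₂.center 15 d)
    (hcard : P₁.card = P₂.card) :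
    (cubeGrid (15 * d) k).VertexDisjointlyLinked P₁ P₂ := by
  match k, f₁, f₂, hf, P₁, P₂, h₁, h₂, hcard with
  | 0, f₁, _, _, _, _, _, _, _ => exact f₁.axis.elim0
  -- The trails need a second axis. In dimension one a face is at most a single point, so
  -- connectedness of the grid suffices.
  | 1, f₁, f₂, hf, P₁, P₂, h₁, h₂, hcard =>
    refine SimpleGraph.vertexDisjointlyLinked_of_forall_separator hcard fun W S hW hW₁ hW₂ => ?_
    have hle : P₁.card ≤ 1 := Finset.card_le_one.2 fun a ha b hb =>
      f₁.subsingleton_verts_one _ (h₁ ha).1 (h₁ hb).1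
    by_contra! hlt
    obtain rfl : S = ∅ := Finset.card_eq_zero.1 (by omega)
    obtain ⟨x, hx⟩ := Finset.card_pos.1 (show 0 < P₁.card by omega)
    obtain ⟨y, hy⟩ := Finset.card_pos.1 (show 0 < P₂.card by omega)
    obtain ⟨p, -⟩ := cubeGrid_exists_staircase x y
    exact hW₂ y hy (p.mem_of_disjoint_support hW (hW₁ x hx (by simp)) (by simp))
  | n + 2, f₁, f₂, hf, P₁, P₂, h₁, h₂, hcard =>
    exact cubeGrid_vertexDisjointlyLinked hf h₁ h₂ hcard
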